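/- Identify $[0,2\pi]$ with the circle group (addition modulo $2\pi$), let $L^2=L^2([0,2\pi])$ be the space of square integrable complex functions, and put $\widehat f(n)=\frac1{2\pi}\int_0^{2\pi}f(t)e^{-int}\,dt$ for $f\in L^2$, $n\in\mathbb Z$. Let $\mathbb N=\{1,2,\dots\}$, let $\delta_x$ be the Dirac measure at $x$, so that $(\delta_x\ast f)(t)=f(t-x)$, and let powers of measures be convolution powers. For $k\ge 0$ let $W^k=\{f\in L^2:\sum_{n\in\mathbb Z}|n|^{2k}|\widehat f(n)|^2<\infty\}$, and let $D$ be the differential operator on $W^1$, given by $\widehat{Df}(n)=in\widehat f(n)$; $I$ is the identity operator. Let $\alpha,\beta\in\mathbb Z$. For $b\in[0,2\pi]$ let $$\mu_b=\left(e^{ib\frac{\alpha-\beta}2}+e^{-ib\frac{\alpha-\beta}2}\right)\delta_0-\left(e^{ib\frac{\alpha+\beta}2}\delta_b+e^{-ib\frac{\alpha+\beta}2}\delta_{-b}\right),\qquad \lambda_b=\tfrac12\mu_b.$$ A function $\lambda_b\ast g$ with $b\in[0,2\pi]$ and $g\in L^2$ is called a generalised difference. (A) For $f\in L^2$ the following conditions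 are equivalent. (i) $\widehat f(\alpha)=\widehat f(\beta)=0$. (ii) There are $m,s\in\mathbb N$, $b_1,\dots,b_m\in[0,2\pi]$ and $f_1,\dots,f_m\in L^2$ with $f=\sum_{j=1}^m\mu_{b_j}^s\ast f_j$. (iii) There are $s\in\mathbb N$, $b_1,\dots,b_{4s+1}\in[0,2\pi]$ and $f_1,\dots,f_{4s+1}\in L^2$ with $f=\sum_{j=1}^{4s+1}\mu_{b_j}^s\ast f_j$. (iv) There are $s\in\mathbb N$ and $g\in W^{2s}$ with $\left(D^2-i(\alpha+\beta)D-\alpha\beta I\right)^s(g)=f$. (iv') There are $s\in\mathbb N$ and $g\in W^{2s}$ with $\left(D^2-i(\alpha+\beta)D-\alpha\beta I\right)(g)=f$. (B) For each given $s\in\mathbb N$, the conditions (i), (ii), (iii), (iv) with this value of $s$ are equivalent for every $f\in L^2$. (C) Let $s\in\mathbb N$, and let $f\in L^2$ satisfy these conditions. Then for almost all $(b_1,\dots,b_{4s+1})\in[0,2\pi]^{4s+1}$ there are $f_1,\dots,f_{4s+1}\in L^2$ with $f=\sum_{j=1}^{4s+1}\mu_{b_j}^s\ast f_j$. (D) For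 each $s\in\mathbb N$, the functions $f\in L^2$ that can be written as $f=\sum_{j=1}^{4s+1}\mu_{b_j}^s\ast f_j$ with $b_j\in[0,2\pi]$ and $f_j\in L^2$ form a closed vector subspace of $L^2$. (E) In particular (the case $s=1$), every $f\in L^2$ with $\widehat f(\alpha)=\widehat f(\beta)=0$ is a sum of five generalised differences. -/

import Mathlib

open MeasureTheory

noncomputable section

namespace GenDiff

instance twoPiPos : Fact (0 < 2 * Real.pi) := ⟨Real.two_pi_pos⟩

/-- The circle group `[0,2π)` with addition modulo `2π`. -/
abbrev Circ : Type := AddCircle (2 * Real.pi)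

/-- `L²([0,2π]) = L²(𝕋)`, complex valued, with respect to `dt/(2π)`. -/
abbrev L2 : Type := Lp ℂ 2 (AddCircle.haarAddCircle : Measure Circ)

/-- The Fourier coefficient `f̂(n) = (1/2π) ∫₀^{2π} f(t) e^{-int} dt`. -/
def coef (f : L2) (n : ℤ) : ℂ := fourierCoeff (f : Circ → ℂ) n

/-! ### Finitely supported complex measures and their convolution -/

/-- The algebra of finitely supported complex measures `∑ c_x δ_x` on the circle: the group
algebra, whose product is the convolution of measures, so that `μ ^ s` is the `s`-fold
convolution power. -/
abbrev FinMeas : Type := AddMonoidAlgebra ℂ Circ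

/-- The Dirac measure at (the class modulo `2π` of) the real number `x`. -/
def dirac (x : ℝ) : FinMeas := AddMonoidAlgebra.single (x : Circ) (1 : ℂ)

/-- `δ_b ∗ f`, that is, the function `x ↦ f (x - b)`. -/
def translate (b : Circ) : L2 →ₗᵢ[ℂ] L2 :=
  Lp.compMeasurePreservingₗᵢ ℂ (fun x : Circ => x - b)
    (measurePreserving_sub_right AddCircle.haarAddCircle b)

/-- The convolution `μ ∗ f = ∑ c_x (δ_x ∗ f)` of `μ = ∑ c_x δ_x` with `f ∈ L²`. -/
def conv (μ : FinMeas) (f : L2) : L2 :=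
  μ.coeff.sum fun b c => c • translate b f

/-- The measure `(e^{ib(α-β)/2} + e^{-ib(α-β)/2}) δ_0 - (e^{ib(α+β)/2} δ_b + e^{-ib(α+β)/2} δ_{-b})`,
where `b` is a real number. -/
def bracket (α β : ℤ) (b : ℝ) : FinMeas :=
  (Complex.exp (Complex.I * b * (((α : ℂ) - β) / 2))
      + Complex.exp (-(Complex.I * b * (((α : ℂ) - β) / 2)))) • dirac 0
    - (Complex.exp (Complex.I * b * (((α : ℂ) + β) / 2)) • dirac b
      + Complex.exp (-(Complex.I * b * (((α : ℂ) + β) / 2))) • dirac (-b))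

/-- The measure `λ_b`, one half of `bracket α β b`. -/
def lam (α β : ℤ) (b : ℝ) : FinMeas := (1 / 2 : ℂ) • bracket α β b

/-- `h` is a generalised difference: `h = λ_b ∗ g` with `b ∈ [0,2π]` and `g ∈ L²`. -/
def IsGeneralisedDifference (α β : ℤ) (h : L2) : Prop :=
  ∃ b ∈ Set.Icc (0 : ℝ) (2 * Real.pi), ∃ g : L2, h = conv (lam α β b) g

/-- `f = ∑_{j=1}^m [⋯]_{b_j}^s ∗ f_j` for some `f_1, …, f_m ∈ L²`. -/
def IsSumWith (α β : ℤ) (s : ℕ) {m : ℕ} (b : Fin m → ℝ) (f : L2) : Prop :=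
  ∃ g : Fin m → L2, f = ∑ j, conv (bracket α β (b j) ^ s) (g j)

/-- `f = ∑_{j=1}^m [⋯]_{b_j}^s ∗ f_j` for some `b_j ∈ [0,2π]` and `f_j ∈ L²`. -/
def IsSum (α β : ℤ) (s m : ℕ) (f : L2) : Prop :=
  ∃ b : Fin m → ℝ, (∀ j, b j ∈ Set.Icc (0 : ℝ) (2 * Real.pi)) ∧ IsSumWith α β s b f

/-! ### Sobolev spaces and the differential operator -/

lemma coef_eq_repr (f : L2) (n : ℤ) : coef f n = fourierBasis.repr f n :=
  (fourierBasis_repr f n).symm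

lemma coef_zero (n : ℤ) : coef 0 n = 0 := by simp [coef_eq_repr]

lemma coef_add (f g : L2) (n : ℤ) : coef (f + g) n = coef f n + coef g n := by
  simp [coef_eq_repr]

lemma coef_smul (c : ℂ) (f : L2) (n : ℤ) : coef (c • f) n = c * coef f n := by
  simp [coef_eq_repr]

lemma coef_ext {f g : L2} (h : ∀ n, coef f n = coef g n) : f = g := by
  apply fourierBasis.repr.injective
  ext n
  simpa [coef_eq_repr] using h n

lemma summable_coef_sq (f : L2) : Summable fun n : ℤ => ‖coef f n‖ ^ 2 :=
  (hasSum_sq_fourierCoeff f).summable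

/-- The Sobolev space `W^k = {f ∈ L² : ∑ |n|^{2k} |f̂(n)|² < ∞}`. -/
def W (k : ℕ) : Submodule ℂ L2 where
  carrier := {f | Summable fun n : ℤ => |(n : ℝ)| ^ (2 * k) * ‖coef f n‖ ^ 2}
  zero_mem' := by simp [coef_zero, summable_zero]
  add_mem' := by
    intro f g hf hg
    refine Summable.of_nonneg_of_le (fun n => by positivity) (fun n => ?_)
      ((hf.mul_left 2).add (hg.mul_left 2))
    have h1 : ‖coef (f + g) n‖ ^ 2 ≤ 2 * ‖coef f n‖ ^ 2 + 2 * ‖coef g n‖ ^ 2 := by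
      rw [coef_add]
      have := norm_add_le (coef f n) (coef g n)
      nlinarith [sq_nonneg (‖coef f n‖ - ‖coef g n‖), norm_nonneg (coef f n + coef g n)]
    have h2 : 0 ≤ |(n : ℝ)| ^ (2 * k) := by positivity
    nlinarith [mul_le_mul_of_nonneg_left h1 h2]
  smul_mem' := by
    intro c f hf
    refine (hf.mul_left (‖c‖ ^ 2)).congr fun n => ?_
    rw [coef_smul, norm_mul]
    ring

lemma mem_W {k : ℕ} {f : L2} :
    f ∈ W k ↔ Summable fun n : ℤ => |(n : ℝ)| ^ (2 * k) * ‖coef f n‖ ^ 2 := Iff.rfl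

lemma W_succ_le (k : ℕ) : W (k + 1) ≤ W k := by
  intro f hf
  refine Summable.of_nonneg_of_le (fun n => by positivity) (fun n => ?_)
    ((summable_coef_sq f).add hf)
  have h : |(n : ℝ)| ^ (2 * k) ≤ 1 + |(n : ℝ)| ^ (2 * (k + 1)) := by
    rcases le_total (|(n : ℝ)|) 1 with h | h
    · have := pow_le_one₀ (n := 2 * k) (abs_nonneg (n : ℝ)) h
      have : 0 ≤ |(n : ℝ)| ^ (2 * (k + 1)) := by positivity
      linarith
    · have := pow_le_pow_right₀ h (show 2 * k ≤ 2 * (k + 1) by omega)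
      linarith
  nlinarith [mul_le_mul_of_nonneg_right h (sq_nonneg ‖coef f n‖)]

/-- The inclusion of `W^{k+1}` in `W^k`. -/
def incl (k : ℕ) : W (k + 1) →ₗ[ℂ] W k := Submodule.inclusion (W_succ_le k)

lemma W_le_one (k : ℕ) : W (k + 1) ≤ W 1 := by
  induction k with
  | zero => exact le_rfl
  | succ k ih => exact (W_succ_le (k + 1)).trans ih

lemma memlp_D {f : L2} (hf : f ∈ W 1) :
    Memℓp (fun n : ℤ => Complex.I * (n : ℂ) * coef f n) 2 := by
  refine memℓp_gen ?_
  have h := mem_W.1 hf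
  refine h.congr fun n => ?_
  simp only [norm_mul, Complex.norm_I, one_mul, Complex.norm_intCast, ENNReal.toReal_ofNat,
    Real.rpow_ofNat]
  ring

/-- `D f` for `f ∈ W¹`: the element of `L²` with Fourier coefficients `i n f̂(n)`. -/
def deriv1 (f : W 1) : L2 :=
  fourierBasis.repr.symm ⟨fun n : ℤ => Complex.I * (n : ℂ) * coef f n, memlp_D f.2⟩

lemma coef_deriv1 (f : W 1) (n : ℤ) :
    coef (deriv1 f) n = Complex.I * (n : ℂ) * coef f n := by
  simp [coef_eq_repr, deriv1]

/-- The differential operator `D`, as a linear map `W^{k+1} → W^k`. -/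
def D (k : ℕ) : W (k + 1) →ₗ[ℂ] W k where
  toFun f := ⟨deriv1 ⟨f, W_le_one k f.2⟩, by
    refine (mem_W.1 f.2).congr fun n => ?_
    rw [coef_deriv1]
    simp only [norm_mul, Complex.norm_I, one_mul, Complex.norm_intCast]
    ring⟩
  map_add' f g := by
    apply Subtype.ext
    apply coef_ext
    intro n
    simp only [Submodule.coe_add, coef_add, coef_deriv1]
    ring
  map_smul' c f := by
    apply Subtype.ext
    apply coef_ext
    intro n
    simp only [Submodule.coe_smul, coef_smul, coef_deriv1, RingHom.id_apply]
    ring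

lemma coef_D (k : ℕ) (f : W (k + 1)) (n : ℤ) :
    coef (D k f : L2) n = Complex.I * (n : ℂ) * coef (f : L2) n := coef_deriv1 _ n

/-- The operator `D² - i(α+β)D - αβ I`, as a linear map `W^{k+2} → W^k`. -/
def P (α β : ℤ) (k : ℕ) : W (k + 2) →ₗ[ℂ] W k :=
  D k ∘ₗ D (k + 1) - (Complex.I * ((α : ℂ) + β)) • (incl k ∘ₗ D (k + 1))
    - ((α : ℂ) * β) • (incl k ∘ₗ incl (k + 1))

/-- The operator `(D² - i(α+β)D - αβ I)^s : W^{2s} → L²`. -/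
def Ppow (α β : ℤ) : (s : ℕ) → W (2 * s) →ₗ[ℂ] L2
  | 0 => (W 0).subtype
  | s + 1 => Ppow α β s ∘ₗ P α β (2 * s)

end GenDiff

end

/-!
Convolution with `bracket α β b` multiplies the `n`-th Fourier coefficient by
`4 sin ((n - α) b / 2) sin ((n - β) b / 2)`, which vanishes at `n = α` and `n = β` for every `b`.
Conversely, `f = ∑ j, μ_j ∗ g_j` can be solved frequency by frequency, and the solutions of minimal
norm belong to `L²` as soon as `∑ n, |f̂(n)|² / ∑ j, |μ̂_j(n)|²` is finite. For `m` measures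
`bracket α β (b j) ^ s`, every term of the inner sum is at most that sum, so its inverse is at most
the product over `j` of the `j`-th terms to the power `-1/m`, and its integral over `[0,2π]^m` is
at most `(∫ |μ̂_b(n)|^(-2s/m) db)^m`. On the circle `x ↦ p x` preserves Haar measure for every
integer `p ≠ 0`, so for `n ≠ α, β` this is bounded, uniformly in `n`, in terms of
`∫ ‖x‖^(-4s/m) dx`, which is finite when `4s < m`. Hence the series converges for almost every `b`
whenever `f̂(α) = f̂(β) = 0`.

The differential operator has the multiplier `-(n - α)(n - β)`, which for `n ≠ α, β` is bounded
below in modulus by a positive multiple of `max(1, |n|)²`.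
-/

noncomputable section

namespace GenDiff

open scoped ENNReal

/-! ### Fourier coefficients -/

/-- The Fourier coefficient `f ↦ f̂(n)` as a continuous linear functional on `L²`. -/
def coefL (n : ℤ) : L2 →L[ℂ] ℂ := innerSL ℂ (fourierBasis n)

lemma coefL_apply (n : ℤ) (f : L2) : coefL n f = coef f n := by
  rw [coefL, innerSL_apply_apply, coef_eq_repr, HilbertBasis.repr_apply_apply]

lemma coef_sum {ι : Type*} (t : Finset ι) (f : ι → L2) (n : ℤ) :
    coef (∑ j ∈ t, f j) n = ∑ j ∈ t, coef (f j) n := by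
  simp only [← coefL_apply, map_sum]

lemma coef_sub (f g : L2) (n : ℤ) : coef (f - g) n = coef f n - coef g n := by
  simp only [← coefL_apply, map_sub]

lemma exists_coef_eq {a : ℤ → ℂ} (ha : Summable fun n => ‖a n‖ ^ 2) :
    ∃ g : L2, ∀ n, coef g n = a n := by
  have ha' : Memℓp a 2 := memℓp_gen (by simpa using ha)
  exact ⟨fourierBasis.repr.symm ⟨a, ha'⟩, fun n => by simp [coef_eq_repr]⟩

/-- The Fourier transform `μ ↦ μ̂(n)` of finitely supported measures; it is multiplicative because
the product of `FinMeas` is convolution. -/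
def hat (n : ℤ) : FinMeas →ₐ[ℂ] ℂ :=
  AddMonoidAlgebra.lift ℂ ℂ Circ
    { toFun := fun x => fourier (-n) x.toAdd
      map_one' := by simp
      map_mul' := fun x y => by simp [fourier_apply, AddCircle.toCircle_add] }

lemma hat_dirac (n : ℤ) (x : ℝ) : hat n (dirac x) = Complex.exp (-(Complex.I * n * x)) := by
  have hpi : (Real.pi : ℂ) ≠ 0 := by exact_mod_cast Real.pi_ne_zero
  calc hat n (dirac x) = fourier (-n) (x : Circ) := by
        simp [hat, dirac, AddMonoidAlgebra.lift_single]
    _ = Complex.exp (-(Complex.I * n * x)) := by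
        rw [fourier_coe_apply]
        congr 1
        push_cast
        field_simp

lemma coef_translate (x : Circ) (f : L2) (n : ℤ) :
    coef (translate x f) n = fourier (-n) x * coef f n := by
  have htranslate : (translate x f : Circ → ℂ) =ᵐ[AddCircle.haarAddCircle] fun y => f (y - x) :=
    Lp.coeFn_compMeasurePreserving f (measurePreserving_sub_right AddCircle.haarAddCircle x)
  have hchar (y : Circ) : fourier (-n) y = fourier (-n) x * (fourier (-n) (y - x) : ℂ) := by
    simp only [fourier_apply]
    rw [← Circle.coe_mul, ← AddCircle.toCircle_add, ← smul_add, add_sub_cancel]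
  calc coef (translate x f) n
      = ∫ y : Circ, fourier (-n) x * (fourier (-n) (y - x) • f (y - x))
          ∂AddCircle.haarAddCircle := by
        rw [coef, fourierCoeff_congr_ae htranslate, fourierCoeff]
        congr 1 with y
        rw [hchar, smul_eq_mul, smul_eq_mul, mul_assoc]
    _ = fourier (-n) x * coef f n := by
        rw [integral_sub_right_eq_self (fun y : Circ => fourier (-n) x * (fourier (-n) y • f y)) x,
          integral_const_mul, coef, fourierCoeff]

lemma coef_conv (μ : FinMeas) (f : L2) (n : ℤ) : coef (conv μ f) n = hat n μ * coef f n := by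
  rw [conv, Finsupp.sum, coef_sum, hat, AddMonoidAlgebra.lift_apply, Finsupp.sum, Finset.sum_mul]
  refine Finset.sum_congr rfl fun x _ => ?_
  rw [coef_smul, coef_translate, ← mul_assoc]
  rfl

lemma hat_bracket (α β n : ℤ) (b : ℝ) :
    hat n (bracket α β b) =
      ((4 * Real.sin ((n - α) * b / 2) * Real.sin ((n - β) * b / 2) : ℝ) : ℂ) := by
  have hcos : hat n (bracket α β b) =
      2 * Complex.cos (b * ((α - β) / 2)) - 2 * Complex.cos (b * (n - (α + β) / 2)) := by
    simp only [bracket, map_sub, map_add, map_smul, hat_dirac, smul_eq_mul, ← Complex.exp_add,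
      Complex.two_cos]
    push_cast
    simp only [mul_zero, neg_zero, Complex.exp_zero, mul_one]
    ring_nf
  rw [hcos, ← mul_sub, Complex.cos_sub_cos]
  push_cast
  have hneg : ((b : ℂ) * ((α - β) / 2) - b * (n - (α + β) / 2)) / 2 = -((n - α) * b / 2) := by
    ring
  rw [hneg, Complex.sin_neg]
  ring_nf

/-! ### Solving `f = ∑ μ_j ∗ g_j` -/

/-- The sum `∑_j |μ̂_j(n)|²`, which governs the solvability of `f = ∑_j μ_j ∗ g_j` frequency by
frequency. It is `ℝ≥0∞`-valued so that its inverse is infinite where all the `μ̂_j(n)` vanish. -/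
def energy {ι : Type*} [Fintype ι] (μ : ι → FinMeas) (n : ℤ) : ℝ≥0∞ :=
  ∑ j, ‖hat n (μ j)‖ₑ ^ 2

-- The minimal norm solution `x = c a⋆ / ‖a‖²`.
lemma exists_sum_mul_eq {ι 𝕜 : Type*} [Fintype ι] [RCLike 𝕜] {a : ι → 𝕜} {c : 𝕜}
    (h : ‖c‖ₑ ^ 2 * (∑ j, ‖a j‖ₑ ^ 2)⁻¹ ≠ ∞) :
    ∃ x : ι → 𝕜, ∑ j, a j * x j = c ∧ ∀ j, ‖x j‖ₑ ^ 2 ≤ ‖c‖ₑ ^ 2 * (∑ i, ‖a i‖ₑ ^ 2)⁻¹ := by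
  rcases eq_or_ne c 0 with rfl | hc
  · exact ⟨0, by simp, by simp⟩
  set S : ℝ≥0∞ := ∑ j, ‖a j‖ₑ ^ 2 with hS
  have hS_top : S ≠ ∞ := ENNReal.sum_ne_top.2 fun _ _ => ENNReal.pow_ne_top enorm_ne_top
  have hS_zero : S ≠ 0 := by
    intro hS0
    rw [hS0, ENNReal.inv_zero, ENNReal.mul_top (pow_ne_zero _ (enorm_ne_zero.2 hc))] at h
    exact h rfl
  have hS_real : S.toReal = ∑ j, ‖a j‖ ^ 2 := by
    rw [hS, ENNReal.toReal_sum fun _ _ => ENNReal.pow_ne_top enorm_ne_top]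
    simp
  have hS_pos : 0 < S.toReal := ENNReal.toReal_pos hS_zero hS_top
  have hS_cast : (S.toReal : 𝕜) ≠ 0 := RCLike.ofReal_ne_zero.2 hS_pos.ne'
  refine ⟨fun j => c * (starRingEnd 𝕜) (a j) / (S.toReal : 𝕜), ?_, fun j => ?_⟩
  · have hterm (j : ι) : a j * (c * (starRingEnd 𝕜) (a j) / (S.toReal : 𝕜)) =
        ((‖a j‖ ^ 2 : ℝ) : 𝕜) * (c / S.toReal) := by
      rw [RCLike.ofReal_pow, ← RCLike.mul_conj]
      ring
    simp only [hterm, ← Finset.sum_mul, ← RCLike.ofReal_sum]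
    rw [← hS_real, mul_div_cancel₀ _ hS_cast]
  · have hle : ‖a j‖ₑ ^ 2 ≤ S :=
      Finset.single_le_sum (f := fun i => ‖a i‖ₑ ^ 2) (fun _ _ => zero_le) (Finset.mem_univ j)
    have hnorm : ‖(S.toReal : 𝕜)⁻¹‖ₑ = S⁻¹ := by
      rw [enorm_inv hS_cast, ← ofReal_norm, RCLike.norm_ofReal, abs_of_pos hS_pos,
        ENNReal.ofReal_toReal hS_top]
    have hconj : ‖(starRingEnd 𝕜) (a j)‖ₑ = ‖a j‖ₑ := by
      rw [← ofReal_norm, RCLike.norm_conj, ofReal_norm]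
    calc ‖c * (starRingEnd 𝕜) (a j) / (S.toReal : 𝕜)‖ₑ ^ 2
        = ‖c‖ₑ ^ 2 * S⁻¹ * (‖a j‖ₑ ^ 2 * S⁻¹) := by
          rw [div_eq_mul_inv, enorm_mul, enorm_mul, hnorm, hconj]
          ring
      _ ≤ ‖c‖ₑ ^ 2 * S⁻¹ * 1 := by
          gcongr
          rw [← div_eq_mul_inv]
          exact ENNReal.div_le_of_le_mul (by rwa [one_mul])
      _ = ‖c‖ₑ ^ 2 * S⁻¹ := mul_one _

theorem exists_eq_sum_conv {ι : Type*} [Fintype ι] {μ : ι → FinMeas} {f : L2}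
    (h : ∑' n, ‖coef f n‖ₑ ^ 2 * (energy μ n)⁻¹ ≠ ∞) :
    ∃ g : ι → L2, f = ∑ j, conv (μ j) (g j) := by
  choose a ha_sum ha_le using fun n => exists_sum_mul_eq (ENNReal.ne_top_of_tsum_ne_top h n)
  have ha_summable (j : ι) : Summable fun n => ‖a n j‖ ^ 2 := by
    have hfin : ∑' n, ‖a n j‖ₑ ^ 2 ≠ ∞ :=
      ne_top_of_le_ne_top h (ENNReal.tsum_le_tsum fun n => ha_le n j)
    simpa using ENNReal.summable_toReal hfin
  choose g hg using fun j => exists_coef_eq (ha_summable j)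
  refine ⟨g, coef_ext fun n => ?_⟩
  simp only [coef_sum, coef_conv, hg, ha_sum]

/-! ### Integrals over the circle and over cubes -/

lemma lintegral_fin_prod_eq_prod {n : ℕ} {E : Fin n → Type*} {mE : ∀ i, MeasurableSpace (E i)}
    {μ : (i : Fin n) → Measure (E i)} [∀ i, SigmaFinite (μ i)] {f : (i : Fin n) → E i → ℝ≥0∞}
    (hf : ∀ i, Measurable (f i)) :
    ∫⁻ x, ∏ i, f i (x i) ∂(Measure.pi μ) = ∏ i, ∫⁻ x, f i x ∂(μ i) := by
  induction n with
  | zero => simp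
  | succ n ih =>
    have hprod : Measurable fun x : (i : Fin n) → E i.succ => ∏ i, f i.succ (x i) :=
      Finset.measurable_prod _ fun i _ => (hf i.succ).comp (measurable_pi_apply i)
    calc ∫⁻ x, ∏ i, f i (x i) ∂(Measure.pi μ)
        = ∫⁻ x : E 0 × ((i : Fin n) → E i.succ), f 0 x.1 * ∏ i : Fin n, f i.succ (x.2 i)
            ∂((μ 0).prod (Measure.pi fun i => μ i.succ)) := by
          refine (lintegral_congr fun x => ?_).trans
            ((measurePreserving_piFinSuccAbove μ 0).lintegral_comp_emb
              (MeasurableEquiv.measurableEmbedding _)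
              fun x => f 0 x.1 * ∏ i : Fin n, f i.succ (x.2 i))
          exact Fin.prod_univ_succ fun i => f i (x i)
      _ = (∫⁻ x, f 0 x ∂(μ 0)) * ∏ i : Fin n, ∫⁻ x, f i.succ x ∂(μ i.succ) := by
          rw [← ih fun i => hf i.succ, ← lintegral_prod_mul (hf 0).aemeasurable hprod.aemeasurable]
      _ = ∏ i, ∫⁻ x, f i x ∂(μ i) := by rw [Fin.prod_univ_succ]

section AddCircle

variable {T : ℝ} [hT : Fact (0 < T)]

lemma lintegral_zsmul_coe {p : ℤ} (hp : p ≠ 0) {f : AddCircle T → ℝ≥0∞} (hf : Measurable f) :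
    ∫⁻ b : ℝ in Set.Icc 0 T, f (p • (b : AddCircle T)) = ∫⁻ x, f x := by
  have hcircle := AddCircle.lintegral_preimage T 0 fun x => f (p • x)
  rw [zero_add] at hcircle
  rw [← Measure.restrict_congr_set Ioc_ae_eq_Icc, hcircle]
  exact (Measure.measurePreserving_zsmul volume hp).lintegral_comp hf

lemma lintegral_enorm_rpow_lt_top {r : ℝ} (hr : -1 < r) :
    ∫⁻ x : AddCircle T, ‖x‖ₑ ^ r < ∞ := by
  have hint : LocallyIntegrable (fun x : ℝ => |x| ^ r) volume :=
    locallyIntegrable_of_norm_le_rpow (C := 1) (α := -r) (by simp) (by simp; linarith)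
      (.of_forall fun x => by
        simp [Real.norm_of_nonneg (Real.rpow_nonneg (abs_nonneg x) r)])
      (measurable_norm.pow_const r).aestronglyMeasurable
  have hioc : IntegrableOn (fun x : ℝ => |x| ^ r) (Set.Ioc (-(T / 2)) (-(T / 2) + T)) :=
    (hint.integrableOn_isCompact isCompact_Icc).mono_set Set.Ioc_subset_Icc_self
  rw [← AddCircle.lintegral_preimage T (-(T / 2))]
  refine lt_of_eq_of_lt (lintegral_congr_ae ?_) hioc.lintegral_lt_top
  rw [Filter.EventuallyEq, ae_restrict_iff' measurableSet_Ioc]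
  filter_upwards [compl_mem_ae_iff.2 (measure_singleton (0 : ℝ))] with x hx hxT
  have hnorm : ‖(x : AddCircle T)‖ = |x| := by
    rw [AddCircle.norm_coe_eq_abs_iff T hT.out.ne', abs_of_pos hT.out, abs_le]
    exact ⟨hxT.1.le, by linarith [hxT.2]⟩
  rw [← ofReal_norm, hnorm, ENNReal.ofReal_rpow_of_pos (abs_pos.2 hx)]

end AddCircle

lemma ae_tsum_mul_ne_top {Ω ι : Type*} [Countable ι] [MeasurableSpace Ω] {μ : Measure Ω}
    {c : ι → ℝ≥0∞} {w : ι → Ω → ℝ≥0∞} {C : ℝ≥0∞} (hw : ∀ i, Measurable (w i))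
    (hc : ∑' i, c i ≠ ∞) (hC : C ≠ ∞) (h : ∀ i, c i ≠ 0 → ∫⁻ x, w i x ∂μ ≤ C) :
    ∀ᵐ x ∂μ, ∑' i, c i * w i x ≠ ∞ := by
  have hmeas (i : ι) : AEMeasurable (fun x => c i * w i x) μ := ((hw i).const_mul _).aemeasurable
  have hle : ∫⁻ x, ∑' i, c i * w i x ∂μ ≤ (∑' i, c i) * C := by
    rw [lintegral_tsum hmeas, ← ENNReal.tsum_mul_right]
    refine ENNReal.tsum_le_tsum fun i => ?_
    rw [lintegral_const_mul _ (hw i)]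
    rcases eq_or_ne (c i) 0 with hci | hci
    · simp [hci]
    · gcongr
      exact h i hci
  filter_upwards [ae_lt_top' (AEMeasurable.tsum hmeas)
    (ne_top_of_le_ne_top (ENNReal.mul_ne_top hc hC) hle)] with x hx
  exact hx.ne

/-! ### The integral of the inverse energy -/

lemma rpow_neg_le_rpow_neg {x y : ℝ≥0∞} {r : ℝ} (hr : 0 ≤ r) (h : x ≤ y) :
    y ^ (-r) ≤ x ^ (-r) := by
  rw [ENNReal.rpow_neg, ENNReal.rpow_neg]
  exact ENNReal.inv_le_inv.2 (ENNReal.rpow_le_rpow h hr)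

lemma mul_rpow_neg_le_add {r : ℝ} (hr : 0 ≤ r) (x y : ℝ≥0∞) :
    (x * y) ^ (-r) ≤ x ^ (-(2 * r)) + y ^ (-(2 * r)) := by
  wlog hxy : x ≤ y generalizing x y
  · rw [mul_comm, add_comm]
    exact this y x (le_of_not_ge hxy)
  calc (x * y) ^ (-r) ≤ (x ^ 2) ^ (-r) := rpow_neg_le_rpow_neg hr (by rw [sq]; gcongr)
    _ = x ^ (-(2 * r)) := by
        rw [← ENNReal.rpow_two, ← ENNReal.rpow_mul, mul_neg]
    _ ≤ x ^ (-(2 * r)) + y ^ (-(2 * r)) := le_self_add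

lemma inv_sum_le_prod_rpow {ι : Type*} [Fintype ι] [Nonempty ι] (a : ι → ℝ≥0∞) :
    (∑ j, a j)⁻¹ ≤ ∏ j, a j ^ (-(Fintype.card ι : ℝ)⁻¹) := by
  have hcard : (Fintype.card ι : ℝ) ≠ 0 := by exact_mod_cast Fintype.card_ne_zero
  calc (∑ i, a i)⁻¹ = ∏ _j : ι, (∑ i, a i) ^ (-(Fintype.card ι : ℝ)⁻¹) := by
        rw [Finset.prod_const, Finset.card_univ, ← ENNReal.rpow_natCast, ← ENNReal.rpow_mul,
          neg_mul, inv_mul_cancel₀ hcard, ENNReal.rpow_neg_one]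
    _ ≤ ∏ j, a j ^ (-(Fintype.card ι : ℝ)⁻¹) :=
        Finset.prod_le_prod' fun j _ => rpow_neg_le_rpow_neg (by positivity)
          (Finset.single_le_sum (fun _ _ => zero_le) (Finset.mem_univ j))

lemma norm_coe_div_pi_le_abs_sin_half (x : ℝ) : ‖(x : Circ)‖ / Real.pi ≤ |Real.sin (x / 2)| := by
  set k : ℤ := round ((2 * Real.pi)⁻¹ * x)
  have hnorm : ‖(x : Circ)‖ = |x - k * (2 * Real.pi)| := AddCircle.norm_eq _
  have hle : |x - k * (2 * Real.pi)| ≤ Real.pi := by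
    have := AddCircle.norm_le_half_period (2 * Real.pi) Real.two_pi_pos.ne' (x := (x : Circ))
    rw [hnorm, abs_of_pos Real.two_pi_pos] at this
    linarith
  have hsin : |Real.sin (x / 2)| = |Real.sin ((x - k * (2 * Real.pi)) / 2)| := by
    rw [show (x - k * (2 * Real.pi)) / 2 = x / 2 - k * Real.pi by ring,
      Real.sin_sub_int_mul_pi, abs_mul, abs_zpow, abs_neg, abs_one, one_zpow, one_mul]
  have hhalf : |(x - k * (2 * Real.pi)) / 2| = |x - k * (2 * Real.pi)| / 2 := by
    rw [abs_div, abs_two]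
  calc ‖(x : Circ)‖ / Real.pi = 2 / Real.pi * |(x - k * (2 * Real.pi)) / 2| := by
        rw [hnorm, hhalf]
        ring
    _ ≤ |Real.sin ((x - k * (2 * Real.pi)) / 2)| :=
        Real.mul_abs_le_abs_sin (by rw [hhalf]; linarith)
    _ = |Real.sin (x / 2)| := hsin.symm

lemma mul_enorm_le_enorm_hat_bracket (α β n : ℤ) (b : ℝ) :
    ENNReal.ofReal (4 / Real.pi ^ 2) * (‖(n - α) • (b : Circ)‖ₑ * ‖(n - β) • (b : Circ)‖ₑ) ≤
      ‖hat n (bracket α β b)‖ₑ := by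
  have hsin (k : ℤ) : ‖(n - k) • (b : Circ)‖ / Real.pi ≤ |Real.sin ((n - k) * b / 2)| := by
    have := norm_coe_div_pi_le_abs_sin_half (((n - k : ℤ) : ℝ) * b)
    rwa [← zsmul_eq_mul, AddCircle.coe_zsmul, zsmul_eq_mul, Int.cast_sub] at this
  rw [← ofReal_norm, ← ofReal_norm, ← ofReal_norm, ← ENNReal.ofReal_mul (norm_nonneg _),
    ← ENNReal.ofReal_mul (by positivity)]
  refine ENNReal.ofReal_le_ofReal ?_
  calc 4 / Real.pi ^ 2 * (‖(n - α) • (b : Circ)‖ * ‖(n - β) • (b : Circ)‖)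
      = 4 * (‖(n - α) • (b : Circ)‖ / Real.pi) * (‖(n - β) • (b : Circ)‖ / Real.pi) := by ring
    _ ≤ 4 * |Real.sin ((n - α) * b / 2)| * |Real.sin ((n - β) * b / 2)| := by
        gcongr
        exacts [hsin α, hsin β]
    _ = ‖hat n (bracket α β b)‖ := by
        rw [hat_bracket, Complex.norm_real, Real.norm_eq_abs, abs_mul, abs_mul, Nat.abs_ofNat]

lemma lintegral_enorm_hat_bracket_rpow_neg_le {r : ℝ} (hr : 0 ≤ r) {α β n : ℤ} (hα : n ≠ α)
    (hβ : n ≠ β) :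
    ∫⁻ b in Set.Icc 0 (2 * Real.pi), ‖hat n (bracket α β b)‖ₑ ^ (-r) ≤
      ENNReal.ofReal (4 / Real.pi ^ 2) ^ (-r) * (2 * ∫⁻ x : Circ, ‖x‖ₑ ^ (-(2 * r))) := by
  have hmeas : Measurable fun x : Circ => ‖x‖ₑ ^ (-(2 * r)) := measurable_enorm.pow_const _
  have hmeas_comp (k : ℤ) : Measurable fun b : ℝ => ‖k • (b : Circ)‖ₑ ^ (-(2 * r)) :=
    hmeas.comp ((measurable_const_smul k).comp AddCircle.measurable_mk')
  have hpoint (b : ℝ) : ‖hat n (bracket α β b)‖ₑ ^ (-r) ≤ ENNReal.ofReal (4 / Real.pi ^ 2) ^ (-r) *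
      (‖(n - α) • (b : Circ)‖ₑ ^ (-(2 * r)) + ‖(n - β) • (b : Circ)‖ₑ ^ (-(2 * r))) := by
    refine (rpow_neg_le_rpow_neg hr (mul_enorm_le_enorm_hat_bracket α β n b)).trans ?_
    rw [ENNReal.mul_rpow_of_ne_top ENNReal.ofReal_ne_top
      (ENNReal.mul_ne_top enorm_ne_top enorm_ne_top)]
    gcongr
    exact mul_rpow_neg_le_add hr _ _
  refine (lintegral_mono hpoint).trans_eq ?_
  rw [lintegral_const_mul _ ((hmeas_comp _).fun_add (hmeas_comp _)),
    lintegral_add_left (hmeas_comp _),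
    lintegral_zsmul_coe (sub_ne_zero.2 hα) hmeas, lintegral_zsmul_coe (sub_ne_zero.2 hβ) hmeas,
    ← two_mul]

/-- The cube `[0,2π]^m` in which the parameters `b_1, …, b_m` range. -/
abbrev cube (m : ℕ) : Set (Fin m → ℝ) := Set.univ.pi fun _ => Set.Icc (0 : ℝ) (2 * Real.pi)

lemma measurable_hat_bracket (α β n : ℤ) : Measurable fun b => hat n (bracket α β b) := by
  simp only [hat_bracket]
  fun_prop

lemma measurable_energy_bracket_pow (α β : ℤ) (s m : ℕ) (n : ℤ) :
    Measurable fun b : Fin m → ℝ => energy (fun j => bracket α β (b j) ^ s) n := by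
  simp only [energy, map_pow]
  exact Finset.measurable_sum _ fun j _ =>
    ((((measurable_hat_bracket α β n).comp (measurable_pi_apply j)).pow_const s).enorm).pow_const 2

lemma lintegral_inv_energy_le_pow (α β : ℤ) (s : ℕ) {m : ℕ} [NeZero m] (n : ℤ) :
    ∫⁻ b in cube m, (energy (fun j => bracket α β (b j) ^ s) n)⁻¹ ≤
      (∫⁻ b in Set.Icc 0 (2 * Real.pi), ‖hat n (bracket α β b)‖ₑ ^ (-(2 * s / m : ℝ))) ^ m := by
  have hpoint (b : Fin m → ℝ) : (energy (fun j => bracket α β (b j) ^ s) n)⁻¹ ≤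
      ∏ j, ‖hat n (bracket α β (b j))‖ₑ ^ (-(2 * s / m : ℝ)) := by
    refine (inv_sum_le_prod_rpow _).trans_eq (Finset.prod_congr rfl fun j _ => ?_)
    rw [map_pow, enorm_pow, ← pow_mul, ← ENNReal.rpow_natCast, ← ENNReal.rpow_mul,
      Fintype.card_fin]
    congr 1
    push_cast
    ring
  refine (lintegral_mono hpoint).trans_eq ?_
  rw [volume_pi, Measure.restrict_pi_pi, lintegral_fin_prod_eq_prod
    (f := fun _ b => ‖hat n (bracket α β b)‖ₑ ^ (-(2 * s / m : ℝ)))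
    fun _ => (measurable_hat_bracket α β n).enorm.pow_const _, Finset.prod_const,
    Finset.card_univ, Fintype.card_fin]

lemma exists_lintegral_inv_energy_le (α β : ℤ) {s m : ℕ} (hm : 4 * s < m) :
    ∃ C : ℝ≥0∞, C ≠ ∞ ∧ ∀ n : ℤ, n ≠ α → n ≠ β →
      ∫⁻ b in cube m, (energy (fun j => bracket α β (b j) ^ s) n)⁻¹ ≤ C := by
  have : NeZero m := ⟨by omega⟩
  set r : ℝ := 2 * s / m
  have hr : -1 < -(2 * r) := by
    have hlt : (4 * s : ℝ) < m := by exact_mod_cast hm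
    have : 2 * r = 4 * s / m := by ring
    rw [this, neg_lt_neg_iff, div_lt_one (by linarith [s.cast_nonneg (α := ℝ)])]
    exact hlt
  refine ⟨(ENNReal.ofReal (4 / Real.pi ^ 2) ^ (-r) * (2 * ∫⁻ x : Circ, ‖x‖ₑ ^ (-(2 * r)))) ^ m,
    ENNReal.pow_ne_top (ENNReal.mul_ne_top ?_ ?_), fun n hα hβ => ?_⟩
  · exact ENNReal.rpow_ne_top_of_ne_zero (ENNReal.ofReal_pos.2 (by positivity)).ne'
      ENNReal.ofReal_ne_top
  · exact ENNReal.mul_ne_top ENNReal.ofNat_ne_top (lintegral_enorm_rpow_lt_top hr).ne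
  · refine (lintegral_inv_energy_le_pow α β s n).trans ?_
    gcongr
    exact lintegral_enorm_hat_bracket_rpow_neg_le (by positivity) hα hβ

/-! ### Sums of generalised differences -/

/-- The space of `f ∈ L²` with `f̂(α) = f̂(β) = 0`. -/
def vanishing (α β : ℤ) : Submodule ℂ L2 := (coefL α).ker ⊓ (coefL β).ker

lemma mem_vanishing {α β : ℤ} {f : L2} : f ∈ vanishing α β ↔ coef f α = 0 ∧ coef f β = 0 := by
  simp [vanishing, coefL_apply]

lemma isClosed_vanishing (α β : ℤ) : IsClosed (vanishing α β : Set L2) :=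
  (coefL α).isClosed_ker.inter (coefL β).isClosed_ker

theorem ae_isSumWith {α β : ℤ} {s m : ℕ} (hm : 4 * s < m) {f : L2} (hf : f ∈ vanishing α β) :
    ∀ᵐ b ∂volume.restrict (cube m), IsSumWith α β s b f := by
  obtain ⟨C, hC, hle⟩ := exists_lintegral_inv_energy_le α β hm
  have hcoef : ∑' n, ‖coef f n‖ₑ ^ 2 ≠ ∞ := by
    simpa [ENNReal.ofReal_pow, ofReal_norm] using (summable_coef_sq f).tsum_ofReal_ne_top
  have hfin := ae_tsum_mul_ne_top (fun n => (measurable_energy_bracket_pow α β s m n).inv)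
    hcoef hC fun n hn => hle n (by rintro rfl; simp [(mem_vanishing.1 hf).1] at hn)
      (by rintro rfl; simp [(mem_vanishing.1 hf).2] at hn)
  filter_upwards [hfin] with b hb
  exact exists_eq_sum_conv hb

lemma isSum_of_mem_vanishing {α β : ℤ} {s m : ℕ} (hm : 4 * s < m) {f : L2}
    (hf : f ∈ vanishing α β) : IsSum α β s m f := by
  have hcube : volume.restrict (cube m) ≠ 0 := by
    rw [Ne, Measure.restrict_eq_zero, volume_pi_pi]
    simp [Real.pi_pos]
  have : (ae (volume.restrict (cube m))).NeBot := ae_neBot.2 hcube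
  have hmem : ∀ᵐ b ∂volume.restrict (cube m), b ∈ cube m :=
    ae_restrict_mem (MeasurableSet.univ_pi fun _ => measurableSet_Icc)
  obtain ⟨b, hsum, hb⟩ := ((ae_isSumWith hm hf).and hmem).exists
  exact ⟨b, fun j => hb j (Set.mem_univ j), hsum⟩

lemma mem_vanishing_of_isSum {α β : ℤ} {s m : ℕ} (hs : s ≠ 0) {f : L2} (h : IsSum α β s m f) :
    f ∈ vanishing α β := by
  obtain ⟨b, -, g, rfl⟩ := h
  simp [mem_vanishing, coef_sum, coef_conv, hat_bracket, hs]

theorem isSum_iff_mem_vanishing {α β : ℤ} {s m : ℕ} (hs : s ≠ 0) (hm : 4 * s < m) {f : L2} :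
    IsSum α β s m f ↔ f ∈ vanishing α β :=
  ⟨mem_vanishing_of_isSum hs, isSum_of_mem_vanishing hm⟩

lemma conv_bracket_eq_conv_lam (α β : ℤ) (b : ℝ) (g : L2) :
    conv (bracket α β b) g = conv (lam α β b) ((2 : ℂ) • g) := by
  refine coef_ext fun n => ?_
  rw [coef_conv, coef_conv, coef_smul, lam, map_smul, smul_eq_mul]
  ring

lemma exists_isGeneralisedDifference_of_isSum {α β : ℤ} {m : ℕ} {f : L2}
    (h : IsSum α β 1 m f) :
    ∃ g : Fin m → L2, (∀ j, IsGeneralisedDifference α β (g j)) ∧ f = ∑ j, g j := by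
  obtain ⟨b, hb, g, rfl⟩ := h
  refine ⟨_, fun j => ⟨b j, hb j, (2 : ℂ) • g j, ?_⟩, rfl⟩
  rw [pow_one, conv_bracket_eq_conv_lam]

/-! ### The range of the differential operator -/

lemma coef_P (α β : ℤ) (k : ℕ) (g : W (k + 2)) (n : ℤ) :
    coef (P α β k g : L2) n = -(((n : ℂ) - α) * (n - β)) * coef (g : L2) n := by
  have hP : (P α β k g : L2) = D k (D (k + 1) g) - (Complex.I * ((α : ℂ) + β)) • D (k + 1) g
      - ((α : ℂ) * β) • (g : L2) := rfl
  rw [hP, coef_sub, coef_sub, coef_smul, coef_smul, coef_D, coef_D]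
  linear_combination (n ^ 2 - (α + β) * n) * coef (g : L2) n * Complex.I_mul_I

lemma coef_Ppow (α β : ℤ) (s : ℕ) (g : W (2 * s)) (n : ℤ) :
    coef (Ppow α β s g) n = (-(((n : ℂ) - α) * (n - β))) ^ s * coef (g : L2) n := by
  induction s with
  | zero => simp [Ppow]
  | succ s ih =>
    change coef (Ppow α β s (P α β (2 * s) g)) n = _
    rw [ih, coef_P, pow_succ, mul_assoc]

lemma exists_mem_W_coef_eq {k : ℕ} {a : ℤ → ℂ}
    (ha : Summable fun n : ℤ => (max 1 |(n : ℝ)| ^ k * ‖a n‖) ^ 2) :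
    ∃ g ∈ W k, ∀ n, coef g n = a n := by
  have ha_sq : Summable fun n => ‖a n‖ ^ 2 :=
    Summable.of_nonneg_of_le (fun _ => by positivity) (fun n => by
      gcongr
      exact le_mul_of_one_le_left (norm_nonneg _) (one_le_pow₀ (le_max_left _ _))) ha
  obtain ⟨g, hg⟩ := exists_coef_eq ha_sq
  refine ⟨g, Summable.of_nonneg_of_le (fun _ => by positivity) (fun n => ?_) ha, hg⟩
  rw [hg, mul_comm 2 k, pow_mul, ← mul_pow]
  gcongr
  exact le_max_right _ _

lemma exists_mem_W_mul_coef_eq {k : ℕ} {q : ℤ → ℂ} {C : ℝ} {f : L2}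
    (hq : ∀ n : ℤ, coef f n ≠ 0 → max 1 |(n : ℝ)| ^ k ≤ C * ‖q n‖) :
    ∃ g ∈ W k, ∀ n, q n * coef g n = coef f n := by
  have hq_ne (n : ℤ) (hn : coef f n ≠ 0) : q n ≠ 0 := by
    intro hqn
    have hle := hq n hn
    rw [hqn, norm_zero, mul_zero] at hle
    exact hle.not_gt (by positivity)
  have hle (n : ℤ) : max 1 |(n : ℝ)| ^ k * ‖(q n)⁻¹ * coef f n‖ ≤ C * ‖coef f n‖ := by
    rcases eq_or_ne (coef f n) 0 with hn | hn
    · simp [hn]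
    calc max 1 |(n : ℝ)| ^ k * ‖(q n)⁻¹ * coef f n‖
        ≤ C * ‖q n‖ * ‖(q n)⁻¹ * coef f n‖ := by
          gcongr
          exact hq n hn
      _ = C * ‖coef f n‖ := by
          rw [mul_assoc, ← norm_mul, mul_inv_cancel_left₀ (hq_ne n hn)]
  have hsum : Summable fun n : ℤ => (max 1 |(n : ℝ)| ^ k * ‖(q n)⁻¹ * coef f n‖) ^ 2 := by
    refine Summable.of_nonneg_of_le (fun _ => by positivity) (fun n => ?_)
      ((summable_coef_sq f).mul_left (C ^ 2))
    rw [← mul_pow]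
    exact pow_le_pow_left₀ (by positivity) (hle n) 2
  obtain ⟨g, hgW, hg⟩ := exists_mem_W_coef_eq hsum
  refine ⟨g, hgW, fun n => ?_⟩
  rcases eq_or_ne (coef f n) 0 with hn | hn
  · simp [hg, hn]
  · rw [hg, mul_inv_cancel_left₀ (hq_ne n hn)]

lemma max_one_abs_le_mul_abs_sub {n a : ℤ} (h : n ≠ a) :
    max 1 |(n : ℝ)| ≤ (1 + |(a : ℝ)|) * |(n : ℝ) - a| := by
  have hone : (1 : ℝ) ≤ |(n : ℝ) - a| := by
    exact_mod_cast Int.one_le_abs (sub_ne_zero.2 h)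
  have htri : |(n : ℝ)| ≤ |(n : ℝ) - a| + |(a : ℝ)| := by
    simpa using abs_add_le ((n : ℝ) - a) a
  have ha : |(a : ℝ)| ≤ |(a : ℝ)| * |(n : ℝ) - a| := le_mul_of_one_le_right (abs_nonneg _) hone
  rw [add_mul, one_mul]
  exact max_le (by linarith [abs_nonneg (a : ℝ)]) (by linarith)

lemma max_one_abs_pow_le_mul_norm {α β n : ℤ} (hα : n ≠ α) (hβ : n ≠ β) (s : ℕ) :
    max 1 |(n : ℝ)| ^ (2 * s) ≤
      ((1 + |(α : ℝ)|) * (1 + |(β : ℝ)|)) ^ s * ‖(-(((n : ℂ) - α) * (n - β))) ^ s‖ := by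
  have hnorm (a : ℤ) : ‖(n : ℂ) - a‖ = |(n : ℝ) - a| := by
    rw [← Real.norm_eq_abs, ← Complex.norm_real]
    push_cast
    rfl
  rw [norm_pow, norm_neg, norm_mul, hnorm, hnorm, ← mul_pow, pow_mul, sq]
  refine pow_le_pow_left₀ (by positivity) ?_ s
  calc max 1 |(n : ℝ)| * max 1 |(n : ℝ)|
      ≤ ((1 + |(α : ℝ)|) * |(n : ℝ) - α|) * ((1 + |(β : ℝ)|) * |(n : ℝ) - β|) := by
        gcongr
        exacts [max_one_abs_le_mul_abs_sub hα, max_one_abs_le_mul_abs_sub hβ]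
    _ = (1 + |(α : ℝ)|) * (1 + |(β : ℝ)|) * (|(n : ℝ) - α| * |(n : ℝ) - β|) := by ring

theorem exists_Ppow_eq_iff {α β : ℤ} {s : ℕ} (hs : s ≠ 0) {f : L2} :
    (∃ g : W (2 * s), Ppow α β s g = f) ↔ f ∈ vanishing α β := by
  constructor
  · rintro ⟨g, rfl⟩
    simp [mem_vanishing, coef_Ppow, hs]
  · intro hf
    rw [mem_vanishing] at hf
    obtain ⟨g, hgW, hg⟩ := exists_mem_W_mul_coef_eq fun n hn => max_one_abs_pow_le_mul_norm
      (by rintro rfl; exact hn hf.1) (by rintro rfl; exact hn hf.2) s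
    exact ⟨⟨g, hgW⟩, coef_ext fun n => by rw [coef_Ppow, hg]⟩

end GenDiff

end

theorem mainTheorem1 (α β : ℤ) :
    -- the equivalence of the conditions, with `m`, `s` quantified inside them
    (∀ f : GenDiff.L2, List.TFAE [
      GenDiff.coef f α = 0 ∧ GenDiff.coef f β = 0,
      ∃ m s : ℕ, 1 ≤ m ∧ 1 ≤ s ∧ GenDiff.IsSum α β s m f,
      ∃ s : ℕ, 1 ≤ s ∧ GenDiff.IsSum α β s (4 * s + 1) f,
      ∃ s : ℕ, 1 ≤ s ∧ ∃ g : GenDiff.W (2 * s), GenDiff.Ppow α β s g = f,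
      ∃ s : ℕ, 1 ≤ s ∧ ∃ g : GenDiff.W 2,
        (g : GenDiff.L2) ∈ GenDiff.W (2 * s) ∧ (GenDiff.P α β 0 g : GenDiff.L2) = f]) ∧
    -- the same for each given `s`
    (∀ s : ℕ, 1 ≤ s → ∀ f : GenDiff.L2, List.TFAE [
      GenDiff.coef f α = 0 ∧ GenDiff.coef f β = 0,
      ∃ m : ℕ, 1 ≤ m ∧ GenDiff.IsSum α β s m f,
      GenDiff.IsSum α β s (4 * s + 1) f,
      ∃ g : GenDiff.W (2 * s), GenDiff.Ppow α β s g = f]) ∧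
    -- almost every choice of `b` in the cube `[0,2π]^{4s+1}` works for a given `f`
    (∀ s : ℕ, 1 ≤ s → ∀ f : GenDiff.L2, GenDiff.coef f α = 0 ∧ GenDiff.coef f β = 0 →
      ∀ᵐ b : Fin (4 * s + 1) → ℝ ∂(MeasureTheory.volume.restrict
        (Set.univ.pi fun _ => Set.Icc (0 : ℝ) (2 * Real.pi))),
        GenDiff.IsSumWith α β s b f) ∧
    -- the functions of the form in question make up a closed subspace
    (∀ s : ℕ, 1 ≤ s → ∃ V : Submodule ℂ GenDiff.L2,
      IsClosed (V : Set GenDiff.L2) ∧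
        (V : Set GenDiff.L2) = {f | GenDiff.IsSum α β s (4 * s + 1) f}) ∧
    -- five generalised differences
    (∀ f : GenDiff.L2, GenDiff.coef f α = 0 ∧ GenDiff.coef f β = 0 →
      ∃ h : Fin 5 → GenDiff.L2,
        (∀ j, GenDiff.IsGeneralisedDifference α β (h j)) ∧ f = ∑ j, h j) := by
  refine ⟨fun f => ?_, fun s hs f => ?_, fun s _ f hf => ?_, fun s hs => ?_, fun f hf => ?_⟩
  · rw [← GenDiff.mem_vanishing]
    tfae_have 1 → 3 := fun hf => ⟨1, le_rfl, GenDiff.isSum_of_mem_vanishing (by omega) hf⟩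
    tfae_have 3 → 2 := fun ⟨s, hs, h⟩ => ⟨4 * s + 1, s, by omega, hs, h⟩
    tfae_have 2 → 1 := fun ⟨_, s, _, hs, h⟩ => GenDiff.mem_vanishing_of_isSum (by omega) h
    tfae_have 1 → 5 := fun hf => by
      obtain ⟨g, hg⟩ := (GenDiff.exists_Ppow_eq_iff one_ne_zero).2 hf
      exact ⟨1, le_rfl, g, g.2, hg⟩
    tfae_have 5 → 4 := fun ⟨_, _, g, _, hg⟩ => ⟨1, le_rfl, g, hg⟩
    tfae_have 4 → 1 := fun ⟨s, hs, h⟩ => (GenDiff.exists_Ppow_eq_iff (by omega)).1 h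
    tfae_finish
  · rw [← GenDiff.mem_vanishing]
    tfae_have 1 → 3 := GenDiff.isSum_of_mem_vanishing (by omega)
    tfae_have 3 → 2 := fun h => ⟨4 * s + 1, by omega, h⟩
    tfae_have 2 → 1 := fun ⟨_, _, h⟩ => GenDiff.mem_vanishing_of_isSum (by omega) h
    tfae_have 4 ↔ 1 := GenDiff.exists_Ppow_eq_iff (by omega)
    tfae_finish
  · exact GenDiff.ae_isSumWith (by omega) (GenDiff.mem_vanishing.2 hf)
  · exact ⟨GenDiff.vanishing α β, GenDiff.isClosed_vanishing α β,
      Set.ext fun f => (GenDiff.isSum_iff_mem_vanishing (by omega) (by omega)).symm⟩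
  · exact GenDiff.exists_isGeneralisedDifference_of_isSum
      (GenDiff.isSum_of_mem_vanishing (by omega) (GenDiff.mem_vanishing.2 hf))
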